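/- For a real number $x$, an integer $q\ge 1$ and an integer $a$, let $\pi(x)$ be the number of primes $p\le x$ and $\pi(x;q,a)$ the number of primes $p\le x$ with $p\equiv a\pmod q$. The Friedlander--Granville--Montgomery conjecture asserts that for every $\varepsilon'>0$ there is a constant $C_{\varepsilon'}$ such that \[ \Big|\pi(x;q,a)-\frac{\pi(x)}{\varphi(q)}\Big|\le C_{\varepsilon'}\,(x/q)^{1/2}\,x^{\varepsilon'}\qquad\text{for all } 1\le q<x \text{ and all } a \text{ with } (a,q)=1. \] For real $x$ and an integer $q\geq 1$ consider the following algorithm. First pick $a$ uniformly at random among the invertible classes modulo $q$, represented by integers in $\{0,\dots,q-1\}$. Then repeat the following main loop forever: pick $t$ uniformly at random in $\{0,\dots,\lfloor (x-a)/q\rfloor\}$, independently of the values of $t$ picked before, set $p=a+tq$, and, if $p$ is prime, return $p$ and stop. A uniform random draw from a set of $N$ elements is counted as $\log_2 N$ random bits; the draw of $a$ is counted too. Assume the Friedlander--Granville--Montgomery conjecture. Let $0<\varepsilon<1$, and for each real $x$ let $q=q(x)\ge 1$ be an integer such that $q(x)\asymp x^{1-\varepsilon}$ as $x\to+\infty$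 (that is, $c\,x^{1-\varepsilon}\le q(x)\le C\,x^{1-\varepsilon}$ for some constants $c,C>0$ and all sufficiently large $x$). Then: 1. for all sufficiently large $x$, the algorithm run with parameters $x$ and $q=q(x)$ terminates almost surely; 2. as $x\to+\infty$, its expected number of iterations of the main loop is $(1+o(1))\,\dfrac{\varphi(q)}{q}\,\log x$; 3. as $x\to+\infty$, the expected number of random bits that it consumes is $(\varepsilon+o(1))\,\dfrac{\varphi(q)}{q}\cdot\dfrac{(\log x)^2}{\log 2}$. -/

import Mathlib

open Filter Topology Asymptotics MeasureTheory ProbabilityTheory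
open scoped ENNReal

namespace PrimeGen

/-- `π(x; q, a)`: the number of primes `p ≤ x` with `p ≡ a (mod q)`. -/
noncomputable def primeCountingAP (x : ℝ) (q a : ℕ) : ℕ :=
  ((Finset.range (⌊x⌋₊ + 1)).filter fun p => p.Prime ∧ p ≡ a [MOD q]).card

/-- The Friedlander--Granville--Montgomery conjecture: for every `ε > 0`,
`|π(x; q, a) - π(x) / φ(q)| ≪_ε (x / q) ^ (1 / 2) * x ^ ε` for all `q < x` and `(a, q) = 1`. -/
def FriedlanderGranvilleMontgomery : Prop :=
  ∀ ε : ℝ, 0 < ε → ∃ C : ℝ, ∀ (x : ℝ) (q a : ℕ), 0 < q → (q : ℝ) < x → a.Coprime q →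
    |(primeCountingAP x q a : ℝ) - (Nat.primeCounting ⌊x⌋₊ : ℝ) / (Nat.totient q : ℝ)|
      ≤ C * (x / q) ^ (1 / 2 : ℝ) * x ^ ε

/-- The invertible classes modulo `q`, as integers in `{0, …, q - 1}` prime to `q`
(hence in `{1, …, q - 1}` as soon as `q ≥ 2`). -/
def unitReps (q : ℕ+) : Finset ℕ :=
  (Finset.range q).filter fun a => (q : ℕ).Coprime a

theorem unitReps_nonempty (q : ℕ+) : (unitReps q).Nonempty :=
  Finset.card_pos.mp (Nat.totient_pos.mpr q.pos)

/-- The set `{0, …, ⌊(x - a) / q⌋}` from which `t` is drawn. (For `a > x`, where the set of the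
algorithm is empty, this is `{0}`; it does not occur when `q ≤ x`.) -/
noncomputable def tRange (x : ℝ) (q : ℕ+) (a : ℕ) : Finset ℕ :=
  Finset.range (⌊(x - a) / (q : ℕ)⌋₊ + 1)

theorem tRange_nonempty (x : ℝ) (q : ℕ+) (a : ℕ) : (tRange x q a).Nonempty :=
  Finset.nonempty_range_iff.mpr (Nat.succ_ne_zero _)

/-- The random choices available to one run of the algorithm: the residue `a`, and the
sequence `t 0, t 1, …` of the values drawn in the successive iterations of the main loop. -/
abbrev Run : Type := ℕ × (ℕ → ℕ)

/-- The uniform distribution of `a` over the invertible classes modulo `q`. -/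
noncomputable def residueLaw (q : ℕ+) : Measure ℕ :=
  (PMF.uniformOfFinset (unitReps q) (unitReps_nonempty q)).toMeasure

/-- Given `a`, the values drawn in the main loop are independent and uniform on
`{0, …, ⌊(x - a) / q⌋}`. -/
noncomputable def loopLaw (x : ℝ) (q : ℕ+) : Kernel ℕ (ℕ → ℕ) :=
  Kernel.ofFunOfCountable fun a => Measure.infinitePi fun _ : ℕ =>
    (PMF.uniformOfFinset (tRange x q a) (tRange_nonempty x q a)).toMeasure

/-- The joint law of all random choices: first `a`, and then, given `a`, the values of `t`. -/
noncomputable def runLaw (x : ℝ) (q : ℕ+) : Measure Run :=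
  residueLaw q ⊗ₘ loopLaw x q

instance (q : ℕ+) : IsProbabilityMeasure (residueLaw q) := by
  unfold residueLaw; infer_instance

instance (x : ℝ) (q : ℕ+) : IsMarkovKernel (loopLaw x q) :=
  ⟨fun a => by
    change IsProbabilityMeasure (Measure.infinitePi fun _ : ℕ =>
      (PMF.uniformOfFinset (tRange x q a) (tRange_nonempty x q a)).toMeasure)
    infer_instance⟩

instance (x : ℝ) (q : ℕ+) : IsProbabilityMeasure (runLaw x q) := by
  unfold runLaw; infer_instance

/-- The number `p = a + t * q` tested in iteration `k + 1` of the main loop. -/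
def candidate (q : ℕ+) (ω : Run) (k : ℕ) : ℕ := ω.1 + ω.2 k * q

/-- The run terminates: some iteration finds a prime, which is then returned. -/
def Terminates (q : ℕ+) (ω : Run) : Prop := ∃ k, (candidate q ω k).Prime

/-- The number of iterations of the main loop, i.e. the (1-based) index of the first iteration
that finds a prime; it is `⊤` if the loop runs forever. -/
noncomputable def iterations (q : ℕ+) (ω : Run) : ℕ∞ :=
  ⨅ (k : ℕ) (_ : (candidate q ω k).Prime), ((k + 1 : ℕ) : ℕ∞)

/-- A uniform draw from a set `S` consumes `log₂ |S|` random bits. -/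
noncomputable def drawBits (S : Finset ℕ) : ℝ≥0∞ := ENNReal.ofReal (Real.logb 2 S.card)

/-- The number of random bits consumed by a run: one draw of `a`, and one draw of `t` in each
iteration of the main loop. -/
noncomputable def randomBits (x : ℝ) (q : ℕ+) (ω : Run) : ℝ≥0∞ :=
  drawBits (unitReps q) + (iterations q ω : ℝ≥0∞) * drawBits (tRange x q ω.1)

end PrimeGen

/-!
By the Friedlander–Granville–Montgomery conjecture and the prime number theorem,
`π(x; q, a) ~ x / (φ(q) log x)` uniformly in the invertible class `a`, because `x / q` is at least a
positive power of `x`. Given `a`, the number of iterations is geometric, with mean `N / π(x; q, a)`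
where `N ~ x / q` is the number of possible values of `t`; hence the expected number of iterations
`(1 + o(1)) (φ(q) / q) log x`. Each iteration costs `log₂ N ~ ε log x / log 2` bits. The draw of `a`
costs at most `log₂ x` bits, which is negligible because `(φ(q) / q) log x → ∞`: indeed
`φ(q) / q ≥ 1 / (ω(q) + 1)`, and `ω(q)! ≤ q` forces `ω(q) = o(log x)`.

The prime number theorem comes from the nonvanishing of `ζ` on `Re s = 1` by the Wiener–Ikehara
argument. In the variable `u = log x`, the averages of `x⁻¹ ∑ n ≤ x, Λ n` against a Fejér kernel of
any width converge by the Riemann–Lebesgue lemma, since the Fourier transform of the kernel is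
compactly supported; the monotonicity of `∑ n ≤ x, Λ n` then allows the width to tend to `0`.
-/

/-- The Fejér kernel `(sin (v / 2) / (v / 2)) ^ 2` of the real line: the Fourier transform of the
triangle function `t ↦ 1 - |t|` on `[-1, 1]`. -/
noncomputable def fejerKernel (v : ℝ) : ℝ := Real.sinc (v / 2) ^ 2

theorem fejerKernel_nonneg (v : ℝ) : 0 ≤ fejerKernel v := sq_nonneg _

theorem continuous_fejerKernel : Continuous fejerKernel :=
  (Real.continuous_sinc.comp (continuous_id.div_const 2)).pow 2

theorem fejerKernel_le_one (v : ℝ) : fejerKernel v ≤ 1 :=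
  (sq_le_one_iff_abs_le_one _).2 (abs_le.2 ⟨Real.neg_one_le_sinc _, Real.sinc_le_one _⟩)

theorem fejerKernel_of_ne_zero {v : ℝ} (hv : v ≠ 0) :
    fejerKernel v = 2 * (1 - Real.cos v) / v ^ 2 := by
  have hcos : Real.cos v = 1 - 2 * Real.sin (v / 2) ^ 2 := by
    rw [Real.sin_sq_eq_half_sub]; ring_nf
  rw [fejerKernel, Real.sinc_of_ne_zero (by simpa using hv), hcos]
  field_simp
  ring

theorem fejerKernel_le_inv_one_add_sq (v : ℝ) : fejerKernel v ≤ 5 * (1 + v ^ 2)⁻¹ := by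
  have hsq : fejerKernel v * v ^ 2 ≤ 4 := by
    rcases eq_or_ne v 0 with rfl | hv
    · norm_num
    · rw [fejerKernel_of_ne_zero hv, div_mul_cancel₀ _ (by positivity)]
      linarith [Real.neg_one_le_cos v]
  rw [← div_eq_mul_inv, le_div_iff₀ (by positivity)]
  linarith [fejerKernel_le_one v]

theorem integrable_fejerKernel : Integrable fejerKernel := by
  refine (integrable_inv_one_add_sq.const_mul 5).mono'
    continuous_fejerKernel.aestronglyMeasurable (ae_of_all _ fun v => ?_)
  rw [Real.norm_of_nonneg (fejerKernel_nonneg v)]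
  exact fejerKernel_le_inv_one_add_sq v

theorem integral_fejerKernel_pos : 0 < ∫ v, fejerKernel v :=
  integral_pos_of_integrable_nonneg_nonzero (x := 0) continuous_fejerKernel integrable_fejerKernel
    fejerKernel_nonneg (by simp [fejerKernel])

theorem integral_one_sub_mul_cos (v : ℝ) :
    ∫ t in (0 : ℝ)..1, 2 * (1 - t) * Real.cos (t * v) = fejerKernel v := by
  rcases eq_or_ne v 0 with rfl | hv
  · have h : ∫ t in (0 : ℝ)..1, 2 * (1 - t) = 1 := by
      rw [intervalIntegral.integral_const_mul, intervalIntegral.integral_sub (by simp) (by simp),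
        integral_id]
      norm_num
    simpa [fejerKernel] using h
  · rw [fejerKernel_of_ne_zero hv]
    have hderiv (t : ℝ) : HasDerivAt (fun t : ℝ => 2 * (1 - t) * Real.sin (t * v) / v
        - 2 * Real.cos (t * v) / v ^ 2) (2 * (1 - t) * Real.cos (t * v)) t := by
      have harg : HasDerivAt (fun t : ℝ => t * v) v t := hasDerivAt_mul_const v
      have hlin : HasDerivAt (fun t : ℝ => 2 * (1 - t)) (-2) t := by
        simpa using ((hasDerivAt_id t).const_sub 1).const_mul 2
      convert! ((hlin.mul harg.sin).div_const v).sub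
        ((harg.cos.const_mul 2).div_const (v ^ 2)) using 1
      field_simp
      ring
    rw [intervalIntegral.integral_eq_sub_of_hasDerivAt (fun t _ => hderiv t)
      (Continuous.intervalIntegrable (by fun_prop) _ _)]
    simp only [sub_self, mul_zero, zero_mul, zero_div, one_mul, sub_zero, mul_one, Real.sin_zero,
      Real.cos_zero]
    field_simp
    ring

theorem integral_one_sub_abs_mul_exp (v : ℝ) :
    ∫ t in (-1 : ℝ)..1, ((1 - |t| : ℝ) : ℂ) * Complex.exp ((t * v : ℝ) * Complex.I) =
      fejerKernel v := by
  have htri (a b : ℝ) : IntervalIntegrable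
      (fun t : ℝ => ((1 - |t| : ℝ) : ℂ) * Complex.exp ((t * v : ℝ) * Complex.I)) volume a b :=
    Continuous.intervalIntegrable (by fun_prop) _ _
  have hneg : ∫ t in (-1 : ℝ)..0, ((1 - |t| : ℝ) : ℂ) * Complex.exp ((t * v : ℝ) * Complex.I) =
      ∫ t in (0 : ℝ)..1, ((1 - |t| : ℝ) : ℂ) * Complex.exp (-((t * v : ℝ) * Complex.I)) := by
    rw [← neg_zero, ← intervalIntegral.integral_comp_neg]
    simp
  rw [← intervalIntegral.integral_add_adjacent_intervals (htri (-1) 0) (htri 0 1), hneg,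
    ← intervalIntegral.integral_add (Continuous.intervalIntegrable (by fun_prop) _ _) (htri 0 1),
    ← integral_one_sub_mul_cos, ← intervalIntegral.integral_ofReal]
  refine intervalIntegral.integral_congr fun t ht => ?_
  rw [Set.uIcc_of_le zero_le_one] at ht
  simp only [abs_of_nonneg ht.1, Complex.ofReal_mul, Complex.ofReal_cos, Complex.cos]
  push_cast
  ring_nf

/-- The (one-sided) Laplace transform of a complex-valued function. -/
noncomputable def laplaceTransform (g : ℝ → ℂ) (z : ℂ) : ℂ :=
  ∫ u in Set.Ioi (0 : ℝ), g u * Complex.exp (-z * u)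

/-- The average of `g` around `y` against the Fejér kernel rescaled to width `1 / l`; it is not
normalised: the mean of a constant `A` is `A * ∫ v, fejerKernel v`. -/
noncomputable def fejerMean {E : Type*} [NormedAddCommGroup E] [NormedSpace ℝ E] (l : ℝ)
    (g : ℝ → E) (y : ℝ) : E :=
  ∫ v, fejerKernel v • g (y - v / l)

section FejerMean

variable {E : Type*} [NormedAddCommGroup E] [NormedSpace ℝ E] {g : ℝ → E} {M : ℝ}

theorem norm_fejerKernel_smul_le (hM : ∀ u, ‖g u‖ ≤ M) (v w : ℝ) :
    ‖fejerKernel v • g w‖ ≤ fejerKernel v * M := by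
  rw [norm_smul, Real.norm_of_nonneg (fejerKernel_nonneg v)]
  exact mul_le_mul_of_nonneg_left (hM w) (fejerKernel_nonneg v)

theorem aestronglyMeasurable_fejerKernel_smul (hg : StronglyMeasurable g) (l y : ℝ) :
    AEStronglyMeasurable fun v => fejerKernel v • g (y - v / l) :=
  continuous_fejerKernel.aestronglyMeasurable.smul
    (hg.comp_measurable (by fun_prop)).aestronglyMeasurable

theorem integrable_fejerKernel_smul (hg : StronglyMeasurable g) (hM : ∀ u, ‖g u‖ ≤ M) (l y : ℝ) :
    Integrable fun v => fejerKernel v • g (y - v / l) :=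
  (integrable_fejerKernel.mul_const M).mono' (aestronglyMeasurable_fejerKernel_smul hg l y)
    (ae_of_all _ fun _ => norm_fejerKernel_smul_le hM _ _)

theorem fejerMean_add {g' : ℝ → E} {M' : ℝ} (hg : StronglyMeasurable g) (hM : ∀ u, ‖g u‖ ≤ M)
    (hg' : StronglyMeasurable g') (hM' : ∀ u, ‖g' u‖ ≤ M') (l y : ℝ) :
    fejerMean l (g + g') y = fejerMean l g y + fejerMean l g' y := by
  simp only [fejerMean, Pi.add_apply, smul_add]
  exact integral_add (integrable_fejerKernel_smul hg hM l y)
    (integrable_fejerKernel_smul hg' hM' l y)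

theorem fejerMean_const (l A y : ℝ) : fejerMean l (fun _ => A) y = A * ∫ v, fejerKernel v := by
  simp only [fejerMean, smul_eq_mul, integral_mul_const, mul_comm A]

theorem ofReal_fejerMean (l : ℝ) (g : ℝ → ℝ) (y : ℝ) :
    ((fejerMean l g y : ℝ) : ℂ) = fejerMean l (fun u => (g u : ℂ)) y := by
  simp only [fejerMean, ← integral_complex_ofReal, smul_eq_mul, Complex.ofReal_mul,
    Complex.real_smul]

theorem tendsto_fejerMean_zero (hg : StronglyMeasurable g) (hM : ∀ u, ‖g u‖ ≤ M)
    (hlim : Tendsto g atTop (𝓝 0)) (l : ℝ) : Tendsto (fejerMean l g) atTop (𝓝 0) := by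
  rw [← integral_zero ℝ E (μ := volume)]
  refine tendsto_integral_filter_of_dominated_convergence (fun v => fejerKernel v * M)
    (Eventually.of_forall (aestronglyMeasurable_fejerKernel_smul hg l))
    (Eventually.of_forall fun y => ae_of_all _ fun v => norm_fejerKernel_smul_le hM _ _)
    (integrable_fejerKernel.mul_const M) (ae_of_all _ fun v => ?_)
  simpa [sub_eq_add_neg] using (hlim.comp
    (tendsto_atTop_add_const_right _ (-(v / l)) tendsto_id)).const_smul (fejerKernel v)

theorem fejerMean_eq_integral {l : ℝ} (hl : 0 < l) (g : ℝ → E) (y : ℝ) :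
    fejerMean l g y = l • ∫ u, fejerKernel (l * (y - u)) • g u := by
  rw [← integral_sub_left_eq_self (fun u => fejerKernel (l * (y - u)) • g u) volume y]
  have h := Measure.integral_comp_div (fun u => fejerKernel (l * u) • g (y - u)) l
  simp only [sub_sub_cancel, mul_div_cancel₀ _ hl.ne', abs_of_pos hl] at h ⊢
  exact h

end FejerMean

section Laplace

variable {g : ℝ → ℂ} {M : ℝ} {F : ℂ → ℂ}

theorem integral_mul_fejerKernel_eq {μ : Measure ℝ} [SFinite μ] {h : ℝ → ℂ} (hh : Integrable h μ)
    (l y : ℝ) :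
    ∫ u, h u * fejerKernel (l * (y - u)) ∂μ =
      ∫ t in (-1 : ℝ)..1, (1 - |t| : ℝ) * Complex.exp ((l * t * y : ℝ) * Complex.I) *
        ∫ u, h u * Complex.exp (-((l * t : ℝ) * Complex.I) * u) ∂μ := by
  have hintegrable : Integrable (Function.uncurry fun (t : ℝ) u =>
      ((1 - |t| : ℝ) : ℂ) * Complex.exp ((t * (l * (y - u)) : ℝ) * Complex.I) * h u)
      ((volume.restrict (Set.uIoc (-1 : ℝ) 1)).prod μ) := by
    have htri : Integrable (fun t : ℝ => ((1 - |t| : ℝ) : ℂ))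
        (volume.restrict (Set.uIoc (-1 : ℝ) 1)) :=
      intervalIntegrable_iff.1 (Continuous.intervalIntegrable (by fun_prop) _ _)
    refine ((htri.mul_prod hh).bdd_mul (c := 1)
      (f := fun p : ℝ × ℝ => Complex.exp ((p.1 * (l * (y - p.2)) : ℝ) * Complex.I))
      (Continuous.aestronglyMeasurable (by fun_prop))
      (ae_of_all _ fun p => (Complex.norm_exp_ofReal_mul_I _).le)).congr (ae_of_all _ fun p => ?_)
    simp only [Function.uncurry]
    ring
  calc ∫ u, h u * fejerKernel (l * (y - u)) ∂μ
    _ = ∫ u, (∫ t in (-1 : ℝ)..1, ((1 - |t| : ℝ) : ℂ) *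
          Complex.exp ((t * (l * (y - u)) : ℝ) * Complex.I) * h u) ∂μ := by
      simp only [intervalIntegral.integral_mul_const, integral_one_sub_abs_mul_exp, mul_comm (h _)]
    _ = ∫ t in (-1 : ℝ)..1, (∫ u, ((1 - |t| : ℝ) : ℂ) *
          Complex.exp ((t * (l * (y - u)) : ℝ) * Complex.I) * h u ∂μ) :=
      (intervalIntegral_integral_swap hintegrable).symm
    _ = _ := by
      refine intervalIntegral.integral_congr fun t _ => ?_
      simp only [← integral_const_mul]
      refine integral_congr_ae (ae_of_all _ fun u => ?_)
      have hexp : Complex.exp ((t * (l * (y - u)) : ℝ) * Complex.I) =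
          Complex.exp ((l * t * y : ℝ) * Complex.I) *
            Complex.exp (-((l * t : ℝ) * Complex.I) * u) := by
        rw [← Complex.exp_add]
        push_cast
        ring_nf
      simp only [hexp]
      ring

theorem tendsto_integral_mul_exp_neg_mul {h : ℝ → ℂ} (hh : IntegrableOn h (Set.Ioi 0)) :
    Tendsto (fun σ : ℝ => ∫ u in Set.Ioi (0 : ℝ), h u * Complex.exp (-σ * u)) (𝓝[>] 0)
      (𝓝 (∫ u in Set.Ioi (0 : ℝ), h u)) := by
  refine tendsto_integral_filter_of_dominated_convergence (fun u => ‖h u‖)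
    (Eventually.of_forall fun σ => hh.aestronglyMeasurable.mul
      (Continuous.aestronglyMeasurable (by fun_prop))) ?_ hh.norm (ae_of_all _ fun u => ?_)
  · filter_upwards [self_mem_nhdsWithin] with σ (hσ : 0 < σ)
    filter_upwards [ae_restrict_mem measurableSet_Ioi] with u (hu : 0 < u)
    rw [norm_mul, ← Complex.ofReal_neg, ← Complex.ofReal_mul, Complex.norm_exp_ofReal]
    exact mul_le_of_le_one_right (norm_nonneg _) (Real.exp_le_one_iff.2 (by nlinarith))
  · have hcont : Continuous fun σ : ℝ => h u * Complex.exp (-σ * u) := by fun_prop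
    simpa using (hcont.tendsto 0).mono_left nhdsWithin_le_nhds

theorem integrableOn_mul_exp_neg_mul (hg : Measurable g) (hM : ∀ u, ‖g u‖ ≤ M) {z : ℂ}
    (hz : 0 < z.re) : IntegrableOn (fun u : ℝ => g u * Complex.exp (-z * u)) (Set.Ioi 0) :=
  (integrableOn_exp_mul_complex_Ioi (by simpa using hz) 0).bdd_mul hg.aestronglyMeasurable
    (ae_of_all _ hM)

theorem integral_mul_fejerKernel_eq_of_laplaceTransform (hg : Measurable g) (hM : ∀ u, ‖g u‖ ≤ M)
    (hFc : ContinuousOn F {z | 0 ≤ z.re}) (hF : Set.EqOn (laplaceTransform g) F {z | 0 < z.re})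
    {l : ℝ} (hl : l ≠ 0) (y : ℝ) :
    ∫ u in Set.Ioi (0 : ℝ), g u * fejerKernel (l * (y - u)) =
      ∫ t in (-1 : ℝ)..1, (1 - |t| : ℝ) * Complex.exp ((l * t * y : ℝ) * Complex.I) *
        F ((l * t : ℝ) * Complex.I) := by
  have hK : Integrable fun u => (fejerKernel (l * (y - u)) : ℂ) :=
    ((integrable_fejerKernel.comp_mul_left' hl).comp_sub_left y).ofReal
  have hdamped := tendsto_integral_mul_exp_neg_mul
    (hK.bdd_mul hg.aestronglyMeasurable (ae_of_all _ hM)).integrableOn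
  have hFmax : Continuous fun p : ℝ × ℝ => F ((max p.1 0 : ℝ) + (l * p.2 : ℝ) * Complex.I) :=
    hFc.comp_continuous (by fun_prop) (by simp)
  have hboundary := (intervalIntegral.continuous_parametric_intervalIntegral_of_continuous'
    (μ := volume) (f := fun σ t : ℝ => ((1 - |t| : ℝ) : ℂ) *
      Complex.exp ((l * t * y : ℝ) * Complex.I) * F ((max σ 0 : ℝ) + (l * t : ℝ) * Complex.I))
    (Continuous.mul (by fun_prop) hFmax) (-1) 1).tendsto 0
  simp only [max_self, Complex.ofReal_zero, zero_add] at hboundary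
  refine tendsto_nhds_unique hdamped
    ((hboundary.mono_left nhdsWithin_le_nhds).congr' ?_)
  filter_upwards [self_mem_nhdsWithin] with σ (hσ : 0 < σ)
  have hfubini := integral_mul_fejerKernel_eq (integrableOn_mul_exp_neg_mul hg hM
    (z := σ) (by simpa using hσ)) l y
  have hLaplace (t : ℝ) : F ((max σ 0 : ℝ) + (l * t : ℝ) * Complex.I) =
      ∫ u in Set.Ioi (0 : ℝ), g u * Complex.exp (-σ * u) *
        Complex.exp (-((l * t : ℝ) * Complex.I) * u) := by
    rw [max_eq_left hσ.le, ← hF (by simpa using hσ), laplaceTransform]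
    simp only [mul_assoc, ← Complex.exp_add, ← add_mul, neg_add]
  simp only [hLaplace, ← hfubini]
  exact integral_congr_ae (ae_of_all _ fun u => mul_right_comm _ _ _)

theorem tendsto_intervalIntegral_exp_mul_atTop (f : ℝ → ℂ) (a b : ℝ) :
    Tendsto (fun y : ℝ => ∫ t in a..b, Complex.exp ((t * y : ℝ) * Complex.I) * f t) atTop
      (𝓝 0) := by
  have hfreq : Tendsto (fun y : ℝ => -(2 * Real.pi)⁻¹ * y) atTop (cocompact ℝ) :=
    (tendsto_id.const_mul_atTop_of_neg (by simp [Real.pi_pos])).mono_right atBot_le_cocompact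
  have hterm (s : Set ℝ) (hs : MeasurableSet s) : Tendsto (fun y : ℝ =>
      ∫ t in s, Complex.exp ((t * y : ℝ) * Complex.I) * f t) atTop (𝓝 0) := by
    refine ((Real.tendsto_integral_exp_smul_cocompact (s.indicator f)).comp hfreq).congr
      fun y => ?_
    rw [← integral_indicator hs]
    refine integral_congr_ae (ae_of_all _ fun t => ?_)
    have hphase : 2 * Real.pi * -(t * (-(2 * Real.pi)⁻¹ * y)) = t * y := by
      field_simp
    by_cases ht : t ∈ s <;>
      simp only [Set.indicator_of_mem, Set.indicator_of_notMem, ht, not_false_eq_true, smul_zero,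
        Circle.smul_def, Real.fourierChar_apply, hphase, smul_eq_mul]
  simpa [intervalIntegral] using (hterm _ measurableSet_Ioc).sub (hterm _ measurableSet_Ioc)

theorem tendsto_fejerMean_of_laplaceTransform (hg : Measurable g) (hM : ∀ u, ‖g u‖ ≤ M)
    (hFc : ContinuousOn F {z | 0 ≤ z.re}) (hF : Set.EqOn (laplaceTransform g) F {z | 0 < z.re})
    {l : ℝ} (hl : 0 < l) : Tendsto (fejerMean l g) atTop (𝓝 0) := by
  have hpos : Tendsto (fejerMean l ((Set.Ioi 0).indicator g)) atTop (𝓝 0) := by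
    have hRL := ((tendsto_intervalIntegral_exp_mul_atTop
      (fun t => ((1 - |t| : ℝ) : ℂ) * F ((l * t : ℝ) * Complex.I)) (-1) 1).comp
        (tendsto_id.const_mul_atTop hl)).const_smul l
    rw [smul_zero] at hRL
    refine hRL.congr fun y => ?_
    have hIoi : ∫ u, fejerKernel (l * (y - u)) • (Set.Ioi 0).indicator g u =
        ∫ u in Set.Ioi (0 : ℝ), g u * fejerKernel (l * (y - u)) := by
      rw [← integral_indicator measurableSet_Ioi]
      refine integral_congr_ae (ae_of_all _ fun u => ?_)
      simp only [Set.indicator_mul_left, Complex.real_smul, mul_comm]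
    rw [fejerMean_eq_integral hl, hIoi,
      integral_mul_fejerKernel_eq_of_laplaceTransform hg hM hFc hF hl.ne']
    simp only [Function.comp_apply, id, mul_left_comm _ l, mul_assoc,
      mul_left_comm _ (Complex.exp _)]
  have hneg : Tendsto (fejerMean l ((Set.Ioi 0)ᶜ.indicator g)) atTop (𝓝 0) := by
    refine tendsto_fejerMean_zero (M := M) (hg.indicator measurableSet_Ioi.compl).stronglyMeasurable
      (fun u => (norm_indicator_le_norm_self _ _).trans (hM u))
      (tendsto_const_nhds.congr' ?_) l
    filter_upwards [eventually_gt_atTop 0] with u hu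
    simp [hu]
  have hsplit := hpos.add hneg
  rw [add_zero] at hsplit
  refine hsplit.congr fun y => ?_
  rw [← fejerMean_add (hg.indicator measurableSet_Ioi).stronglyMeasurable
    (fun u => (norm_indicator_le_norm_self _ _).trans (hM u))
    (hg.indicator measurableSet_Ioi.compl).stronglyMeasurable
    (fun u => (norm_indicator_le_norm_self _ _).trans (hM u)), Set.indicator_self_add_compl]

end Laplace

theorem tendsto_fejerMean_of_laplaceTransform_sub_const {g : ℝ → ℝ} {M A : ℝ} {F : ℂ → ℂ}
    (hg : Measurable g) (hM : ∀ u, ‖g u‖ ≤ M) (hFc : ContinuousOn F {z | 0 ≤ z.re})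
    (hF : Set.EqOn (laplaceTransform fun u => ((g u - A : ℝ) : ℂ)) F {z | 0 < z.re})
    {l : ℝ} (hl : 0 < l) :
    Tendsto (fejerMean l g) atTop (𝓝 (A * ∫ v, fejerKernel v)) := by
  have hM' (u : ℝ) : ‖g u - A‖ ≤ M + ‖A‖ := (norm_sub_le _ _).trans (by gcongr; exact hM u)
  have hsub : Tendsto (fejerMean l fun u => g u - A) atTop (𝓝 0) := by
    have h := (Complex.continuous_re.tendsto 0).comp (tendsto_fejerMean_of_laplaceTransform
      (Complex.measurable_ofReal.comp (hg.sub_const A))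
      (fun u => (Complex.norm_real _).trans_le (hM' u)) hFc hF hl)
    refine h.congr fun y => ?_
    exact congrArg Complex.re (ofReal_fejerMean l (fun u => g u - A) y).symm
  have hadd := hsub.add_const (A * ∫ v, fejerKernel v)
  rw [zero_add] at hadd
  refine hadd.congr fun y => ?_
  rw [← fejerMean_const l A y, ← fejerMean_add (hg.sub_const A).stronglyMeasurable hM'
    stronglyMeasurable_const (fun _ => le_rfl)]
  congr 1 with u
  exact sub_add_cancel _ _

theorem tendsto_setIntegral_Icc_neg_self {f : ℝ → ℝ} (hf : Integrable f) :
    Tendsto (fun r => ∫ v in Set.Icc (-r) r, f v) atTop (𝓝 (∫ v, f v)) :=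
  (aecover_Icc tendsto_neg_atTop_atBot tendsto_id).integral_tendsto_of_countably_generated hf

section Tauberian

variable {H : ℝ → ℝ} {M A : ℝ}

theorem le_exp_sub_mul_of_monotone_exp_mul (hmono : Monotone fun u => Real.exp u * H u) {u w : ℝ}
    (huw : u ≤ w) : H u ≤ Real.exp (w - u) * H w := by
  rw [Real.exp_sub, div_mul_eq_mul_div, le_div_iff₀' (Real.exp_pos u)]
  exact hmono huw

theorem measurable_of_monotone_exp_mul (hmono : Monotone fun u => Real.exp u * H u) :
    Measurable H := by
  have h : Measurable fun u => Real.exp (-u) * (Real.exp u * H u) :=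
    (Real.measurable_exp.comp measurable_neg).mul hmono.measurable
  simpa only [← mul_assoc, ← Real.exp_add, neg_add_cancel, Real.exp_zero, one_mul] using h

theorem exp_neg_mul_mul_le_fejerMean (hmono : Monotone fun u => Real.exp u * H u)
    (hH : ∀ u, 0 ≤ H u) (hM : ∀ u, H u ≤ M) {l : ℝ} (hl : 0 < l) (r y : ℝ) :
    Real.exp (-(2 * (r / l))) * H y * ∫ v in Set.Icc (-r) r, fejerKernel v ≤
      fejerMean l H (y + r / l) := by
  have hintegrable : Integrable fun v => fejerKernel v • H (y + r / l - v / l) :=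
    integrable_fejerKernel_smul (measurable_of_monotone_exp_mul hmono).stronglyMeasurable
      (fun u => (Real.norm_of_nonneg (hH u)).trans_le (hM u)) l _
  have hwindow {v : ℝ} (hv : v ∈ Set.Icc (-r) r) :
      Real.exp (-(2 * (r / l))) * H y ≤ H (y + r / l - v / l) := by
    have hv₁ : v / l ≤ r / l := by gcongr; exact hv.2
    have hv₂ : -(r / l) ≤ v / l := by rw [← neg_div]; gcongr; exact hv.1
    rw [Real.exp_neg, inv_mul_le_iff₀ (Real.exp_pos _)]
    refine (le_exp_sub_mul_of_monotone_exp_mul hmono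
      (w := y + r / l - v / l) (by linarith)).trans ?_
    gcongr
    · exact hH _
    · linarith
  calc Real.exp (-(2 * (r / l))) * H y * ∫ v in Set.Icc (-r) r, fejerKernel v
    _ = ∫ v in Set.Icc (-r) r, Real.exp (-(2 * (r / l))) * H y * fejerKernel v :=
      (integral_const_mul _ _).symm
    _ ≤ ∫ v in Set.Icc (-r) r, fejerKernel v • H (y + r / l - v / l) := by
      refine setIntegral_mono_on (integrable_fejerKernel.integrableOn.const_mul _)
        hintegrable.integrableOn measurableSet_Icc fun v hv => ?_
      rw [smul_eq_mul, mul_comm (fejerKernel v)]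
      exact mul_le_mul_of_nonneg_right (hwindow hv) (fejerKernel_nonneg v)
    _ ≤ fejerMean l H (y + r / l) := setIntegral_le_integral hintegrable
      (ae_of_all _ fun v => mul_nonneg (fejerKernel_nonneg v) (hH _))

theorem fejerMean_le (hmono : Monotone fun u => Real.exp u * H u) (hH : ∀ u, 0 ≤ H u)
    (hM : ∀ u, H u ≤ M) {l : ℝ} (hl : 0 < l) (r y : ℝ) :
    fejerMean l H (y - r / l) ≤ Real.exp (2 * (r / l)) * H y * (∫ v, fejerKernel v) +
      M * ((∫ v, fejerKernel v) - ∫ v in Set.Icc (-r) r, fejerKernel v) := by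
  have hintegrable : Integrable fun v => fejerKernel v • H (y - r / l - v / l) :=
    integrable_fejerKernel_smul (measurable_of_monotone_exp_mul hmono).stronglyMeasurable
      (fun u => (Real.norm_of_nonneg (hH u)).trans_le (hM u)) l _
  have hK := integrable_fejerKernel
  have hKi := hK.indicator (measurableSet_Icc (a := -r) (b := r))
  have htail : Integrable fun v => fejerKernel v - (Set.Icc (-r) r).indicator fejerKernel v :=
    hK.sub hKi
  rw [← integral_indicator measurableSet_Icc, ← integral_sub hK hKi, ← integral_const_mul,
    ← integral_const_mul, ← integral_add (hK.const_mul _) (htail.const_mul M)]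
  refine integral_mono hintegrable ((hK.const_mul _).add (htail.const_mul M)) fun v => ?_
  have hKv := fejerKernel_nonneg v
  simp only [smul_eq_mul, mul_comm (fejerKernel v)]
  by_cases hv : v ∈ Set.Icc (-r) r
  · have hv₁ : v / l ≤ r / l := by gcongr; exact hv.2
    have hv₂ : -(r / l) ≤ v / l := by rw [← neg_div]; gcongr; exact hv.1
    rw [Set.indicator_of_mem hv, sub_self, mul_zero, add_zero]
    refine mul_le_mul_of_nonneg_right ?_ hKv
    refine (le_exp_sub_mul_of_monotone_exp_mul hmono (w := y) (by linarith)).trans ?_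
    gcongr
    · exact hH _
    · linarith
  · rw [Set.indicator_of_notMem hv, sub_zero]
    have htail := mul_le_mul_of_nonneg_right (hM (y - r / l - v / l)) hKv
    have hmain : 0 ≤ Real.exp (2 * (r / l)) * H y * fejerKernel v :=
      mul_nonneg (mul_nonneg (Real.exp_pos _).le (hH y)) hKv
    linarith

theorem tendsto_of_tendsto_fejerMean (hmono : Monotone fun u => Real.exp u * H u)
    (hH : ∀ u, 0 ≤ H u) (hM : ∀ u, H u ≤ M)
    (hmean : ∀ l, 0 < l → Tendsto (fejerMean l H) atTop (𝓝 (A * ∫ v, fejerKernel v))) :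
    Tendsto H atTop (𝓝 A) := by
  set c := ∫ v, fejerKernel v
  set ρ : ℝ → ℝ := fun r => ∫ v in Set.Icc (-r) r, fejerKernel v
  have hc : 0 < c := integral_fejerKernel_pos
  have hρ : Tendsto ρ atTop (𝓝 c) := tendsto_setIntegral_Icc_neg_self integrable_fejerKernel
  -- With `l = r ^ 2`, the window `|v| ≤ r` exhausts the mass of the kernel while the corresponding
  -- shift `r / l` of the argument of `H` tends to `0`.
  have hwidth : Tendsto (fun r : ℝ => r / r ^ 2) atTop (𝓝 0) := by
    simpa [pow_two] using tendsto_inv_atTop_zero (𝕜 := ℝ)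
  have hexp : Tendsto (fun r : ℝ => Real.exp (2 * (r / r ^ 2))) atTop (𝓝 1) := by
    simpa using (hwidth.const_mul 2).rexp
  have hexp_neg : Tendsto (fun r : ℝ => Real.exp (-(2 * (r / r ^ 2)))) atTop (𝓝 1) := by
    simpa using (hwidth.const_mul 2).neg.rexp
  refine tendsto_order.2 ⟨fun a ha => ?_, fun a ha => ?_⟩
  · have hlim : Tendsto (fun r => Real.exp (2 * (r / r ^ 2)) * a * c + M * (c - ρ r)) atTop
        (𝓝 (a * c)) := by
      simpa using ((hexp.mul_const a).mul_const c).add ((hρ.const_sub c).const_mul M)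
    obtain ⟨r, hr, hr₀⟩ := ((hlim.eventually_lt_const (mul_lt_mul_of_pos_right ha hc)).and
      (eventually_gt_atTop 0)).exists
    filter_upwards [((hmean (r ^ 2) (by positivity)).comp (tendsto_atTop_add_const_right _
      (-(r / r ^ 2)) tendsto_id)).eventually_const_lt hr] with y hy
    have hle := hy.trans_le (fejerMean_le hmono hH hM (by positivity : 0 < r ^ 2) r y)
    have hle' : Real.exp (2 * (r / r ^ 2)) * a * c < Real.exp (2 * (r / r ^ 2)) * H y * c := by
      linarith
    exact lt_of_mul_lt_mul_left (lt_of_mul_lt_mul_right hle' hc.le) (Real.exp_pos _).le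
  · have hlim : Tendsto (fun r => Real.exp (-(2 * (r / r ^ 2))) * a * ρ r) atTop
        (𝓝 (a * c)) := by
      simpa using (hexp_neg.mul_const a).mul hρ
    obtain ⟨r, hr, hρr, hr₀⟩ := ((hlim.eventually_const_lt (mul_lt_mul_of_pos_right ha hc)).and
      ((hρ.eventually_const_lt hc).and (eventually_gt_atTop 0))).exists
    filter_upwards [((hmean (r ^ 2) (by positivity)).comp (tendsto_atTop_add_const_right _
      (r / r ^ 2) tendsto_id)).eventually_lt_const hr] with y hy
    have hlt :=
      (exp_neg_mul_mul_le_fejerMean hmono hH hM (by positivity : 0 < r ^ 2) r y).trans_lt hy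
    exact lt_of_mul_lt_mul_left (lt_of_mul_lt_mul_right hlt hρr.le) (Real.exp_pos _).le

end Tauberian

section WienerIkehara

theorem laplaceTransform_sub_const {g : ℝ → ℂ} (A : ℂ) {z : ℂ} (hz : 0 < z.re)
    (hg : IntegrableOn (fun u : ℝ => g u * Complex.exp (-z * u)) (Set.Ioi 0)) :
    laplaceTransform (fun u => g u - A) z = laplaceTransform g z - A / z := by
  have hexp := integrableOn_exp_mul_complex_Ioi (a := -z) (by simpa using hz) 0
  simp only [laplaceTransform, sub_mul]
  rw [integral_sub hg (hexp.const_mul A), integral_const_mul,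
    integral_exp_mul_complex_Ioi (by simpa using hz)]
  simp [div_eq_mul_inv]

/-- The mean `x⁻¹ * ∑ n ≤ x, f n` as a function of the logarithmic variable `u = log x`. -/
noncomputable def logScaleMean (f : ℕ → ℝ) (u : ℝ) : ℝ :=
  (∑ k ∈ Finset.Icc 1 ⌊Real.exp u⌋₊, f k) * Real.exp (-u)

variable {f : ℕ → ℝ}

theorem logScaleMean_nonneg (hf : ∀ n, 0 ≤ f n) (u : ℝ) : 0 ≤ logScaleMean f u :=
  mul_nonneg (Finset.sum_nonneg fun n _ => hf n) (Real.exp_pos _).le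

theorem monotone_exp_mul_logScaleMean (hf : ∀ n, 0 ≤ f n) :
    Monotone fun u => Real.exp u * logScaleMean f u := by
  have hexp_mul (u : ℝ) :
      Real.exp u * logScaleMean f u = ∑ k ∈ Finset.Icc 1 ⌊Real.exp u⌋₊, f k := by
    rw [logScaleMean, mul_left_comm, ← Real.exp_add, add_neg_cancel, Real.exp_zero, mul_one]
  intro u w huw
  simp only [hexp_mul]
  exact Finset.sum_le_sum_of_subset_of_nonneg (Finset.Icc_subset_Icc_right
    (Nat.floor_le_floor (Real.exp_le_exp.2 huw))) fun n _ _ => hf n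

theorem exists_logScaleMean_le
    (hO : (fun n => ∑ k ∈ Finset.Icc 1 n, f k) =O[atTop] fun n => (n : ℝ)) :
    ∃ C, ∀ u, logScaleMean f u ≤ C := by
  obtain ⟨C, hC⟩ := (isBigO_nat_atTop_iff (by simp)).1 hO
  have hC₀ : 0 ≤ C := by simpa using (norm_nonneg _).trans (hC 1)
  refine ⟨C, fun u => ?_⟩
  rw [logScaleMean, Real.exp_neg, ← div_eq_mul_inv, div_le_iff₀ (Real.exp_pos u)]
  refine ((le_abs_self _).trans (hC _)).trans ?_
  rw [Real.norm_natCast]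
  gcongr
  exact Nat.floor_le (Real.exp_pos u).le

theorem laplaceTransform_logScaleMean (hf : ∀ n, 0 ≤ f n)
    (hO : (fun n => ∑ k ∈ Finset.Icc 1 n, f k) =O[atTop] fun n => (n : ℝ)) {z : ℂ}
    (hz : 0 < z.re) :
    laplaceTransform (fun u => (logScaleMean f u : ℂ)) z =
      LSeries (fun n => (f n : ℂ)) (1 + z) / (1 + z) := by
  have hre : 1 < (1 + z).re := by simpa using hz
  rw [LSeries_eq_mul_integral_of_nonneg f zero_le_one hre (by simpa using hO) hf,
    mul_div_cancel_left₀ _ (Complex.ne_zero_of_one_lt_re hre), ← Real.exp_zero,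
    ← integral_comp_exp_Ioi, laplaceTransform]
  refine integral_congr_ae (ae_of_all _ fun u => ?_)
  have hcpow : ((Real.exp u : ℝ) : ℂ) ^ (-(1 + z + 1)) = Complex.exp (u * (-(1 + z + 1))) := by
    rw [Complex.cpow_def_of_ne_zero (Complex.ofReal_ne_zero.2 (Real.exp_ne_zero u)),
      ← Complex.ofReal_log (Real.exp_pos u).le, Real.log_exp]
  have hexp : Complex.exp ((-u : ℝ) : ℂ) * Complex.exp (-z * u) =
      Complex.exp (u : ℂ) * Complex.exp (u * (-(1 + z + 1))) := by
    rw [← Complex.exp_add, ← Complex.exp_add]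
    push_cast
    ring_nf
  simp only [hcpow, logScaleMean, Complex.real_smul, Complex.ofReal_mul, Complex.ofReal_sum]
  push_cast at hexp ⊢
  linear_combination (∑ k ∈ Finset.Icc 1 ⌊Real.exp u⌋₊, (f k : ℂ)) * hexp

theorem laplaceTransform_logScaleMean_sub_const {A : ℝ} {G : ℂ → ℂ} (hf : ∀ n, 0 ≤ f n)
    (hO : (fun n => ∑ k ∈ Finset.Icc 1 n, f k) =O[atTop] fun n => (n : ℝ))
    (hG : Set.EqOn G (fun s => LSeries (fun n => (f n : ℂ)) s - A / (s - 1)) {s | 1 < s.re}) :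
    Set.EqOn (laplaceTransform fun u => ((logScaleMean f u - A : ℝ) : ℂ))
      (fun z => (G (1 + z) - A) / (1 + z)) {z | 0 < z.re} := by
  intro z (hz : 0 < z.re)
  obtain ⟨C, hC⟩ := exists_logScaleMean_le hO
  have hz₀ : z ≠ 0 := Complex.ne_zero_of_re_pos hz
  have hz₁ : 1 + z ≠ 0 := Complex.ne_zero_of_one_lt_re (by simpa using hz)
  have hintegrable : IntegrableOn (fun u : ℝ => (logScaleMean f u : ℂ) * Complex.exp (-z * u))
      (Set.Ioi 0) :=
    integrableOn_mul_exp_neg_mul (M := C) (Complex.measurable_ofReal.comp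
      (measurable_of_monotone_exp_mul (monotone_exp_mul_logScaleMean hf)))
      (fun u => by simpa [abs_of_nonneg (logScaleMean_nonneg hf u)] using hC u) hz
  simp only [Complex.ofReal_sub]
  rw [laplaceTransform_sub_const _ hz hintegrable, laplaceTransform_logScaleMean hf hO hz,
    hG (by simpa using hz)]
  simp only [add_sub_cancel_left]
  field_simp
  ring

theorem tendsto_partialSum_div_of_LSeries {A : ℝ} {G : ℂ → ℂ} (hf : ∀ n, 0 ≤ f n)
    (hO : (fun n => ∑ k ∈ Finset.Icc 1 n, f k) =O[atTop] fun n => (n : ℝ))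
    (hGc : ContinuousOn G {s | 1 ≤ s.re})
    (hG : Set.EqOn G (fun s => LSeries (fun n => (f n : ℂ)) s - A / (s - 1)) {s | 1 < s.re}) :
    Tendsto (fun x : ℝ => (∑ k ∈ Finset.Icc 1 ⌊x⌋₊, f k) / x) atTop (𝓝 A) := by
  have hmono := monotone_exp_mul_logScaleMean hf
  obtain ⟨C, hC⟩ := exists_logScaleMean_le hO
  have hcont : ContinuousOn (fun z => (G (1 + z) - A) / (1 + z)) {z | 0 ≤ z.re} := by
    refine ContinuousOn.div (ContinuousOn.sub (hGc.comp (by fun_prop) fun z hz => ?_)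
      continuousOn_const) (by fun_prop) fun z hz => ?_
    · simpa using hz
    · exact Complex.ne_zero_of_re_pos (by simpa using add_pos_of_pos_of_nonneg one_pos hz)
  have hmean (l : ℝ) (hl : 0 < l) := tendsto_fejerMean_of_laplaceTransform_sub_const (M := C)
    (measurable_of_monotone_exp_mul hmono)
    (fun u => (Real.norm_of_nonneg (logScaleMean_nonneg hf u)).trans_le (hC u)) hcont
    (laplaceTransform_logScaleMean_sub_const hf hO hG) hl
  refine ((tendsto_of_tendsto_fejerMean hmono (logScaleMean_nonneg hf) hC hmean).comp
    Real.tendsto_log_atTop).congr' ?_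
  filter_upwards [eventually_gt_atTop 0] with x hx
  rw [Function.comp_apply, logScaleMean, Real.exp_neg, Real.exp_log hx, div_eq_mul_inv]

end WienerIkehara

section PrimeNumberTheorem

theorem eqOn_LFunctionResidueClassAux_one : Set.EqOn
    (ArithmeticFunction.vonMangoldt.LFunctionResidueClassAux (1 : ZMod 1))
    (fun s => LSeries (fun n => (ArithmeticFunction.vonMangoldt n : ℂ)) s - (1 : ℝ) / (s - 1))
    {s | 1 < s.re} := by
  have hres : ArithmeticFunction.vonMangoldt.residueClass (1 : ZMod 1) =
      fun n => ArithmeticFunction.vonMangoldt n := by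
    funext n
    simp [ArithmeticFunction.vonMangoldt.residueClass, Set.indicator,
      Subsingleton.elim (n : ZMod 1) 1]
  simpa [hres] using ArithmeticFunction.vonMangoldt.eqOn_LFunctionResidueClassAux
    (isUnit_one : IsUnit (1 : ZMod 1))

theorem tendsto_psi_div : Tendsto (fun x => Chebyshev.psi x / x) atTop (𝓝 1) := by
  have hO : (fun n => ∑ k ∈ Finset.Icc 1 n, ArithmeticFunction.vonMangoldt k) =O[atTop]
      fun n => (n : ℝ) := by
    refine .of_bound (Real.log 4 + 4) (Eventually.of_forall fun n => ?_)
    have hpsi : Chebyshev.psi n = ∑ k ∈ Finset.Icc 1 n, ArithmeticFunction.vonMangoldt k := by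
      rw [Chebyshev.psi, Nat.floor_natCast]
      rfl
    rw [← hpsi, Real.norm_of_nonneg (Chebyshev.psi_nonneg _), Real.norm_natCast]
    exact Chebyshev.psi_le_const_mul_self n.cast_nonneg
  exact tendsto_partialSum_div_of_LSeries (fun n => ArithmeticFunction.vonMangoldt_nonneg) hO
    (ArithmeticFunction.vonMangoldt.continuousOn_LFunctionResidueClassAux (1 : ZMod 1))
    eqOn_LFunctionResidueClassAux_one

theorem tendsto_theta_div : Tendsto (fun x => Chebyshev.theta x / x) atTop (𝓝 1) := by
  have hsqrt : (fun x => √x) =o[atTop] fun x : ℝ => x := by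
    refine isLittleO_of_tendsto (by simp +contextual) ?_
    simp only [Real.sqrt_div_self]
    exact Real.tendsto_sqrt_atTop.inv_tendsto_atTop
  have hdiff := (Chebyshev.isBigO_psi_sub_theta_sqrt.trans_isLittleO hsqrt).tendsto_div_nhds_zero
  simpa [sub_div] using tendsto_psi_div.sub hdiff

theorem tendsto_primeCounting_mul_log_div :
    Tendsto (fun x : ℝ => (Nat.primeCounting ⌊x⌋₊ : ℝ) * Real.log x / x) atTop (𝓝 1) := by
  have hsum := tendsto_theta_div.add
    Chebyshev.integral_theta_div_log_sq_isLittleO.tendsto_div_nhds_zero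
  rw [add_zero] at hsum
  refine hsum.congr' ?_
  filter_upwards [eventually_ge_atTop 2] with x hx
  have hlog : 0 < Real.log x := Real.log_pos (by linarith)
  rw [Chebyshev.primeCounting_eq_theta_div_log_add_integral hx]
  field_simp

end PrimeNumberTheorem

theorem prod_range_add_le_prod {R : Type*} [CommSemiring R] [PartialOrder R] [IsOrderedRing R]
    {f : ℕ → R} {m : ℕ} (hf : MonotoneOn f (Set.Ici m)) (h₀ : 0 ≤ f m) {S : Finset ℕ}
    (hS : ∀ n ∈ S, m ≤ n) : ∏ i ∈ Finset.range S.card, f (m + i) ≤ ∏ n ∈ S, f n := by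
  induction S using Finset.induction_on_max with
  | empty => simp
  | insert a S hmax ih =>
    have nonneg (n : ℕ) (hn : m ≤ n) : 0 ≤ f n := h₀.trans (hf Set.self_mem_Ici hn hn)
    have hle : m + S.card ≤ a := by
      have hsub : S ⊆ Finset.Ico m a := fun n hn =>
        Finset.mem_Ico.2 ⟨hS n (Finset.mem_insert_of_mem hn), hmax n hn⟩
      have hcard := Finset.card_le_card hsub
      have hma := hS a (Finset.mem_insert_self a S)
      rw [Nat.card_Ico] at hcard
      lia
    have ha : a ∉ S := fun h => (hmax a h).false
    rw [Finset.prod_insert ha, Finset.card_insert_of_notMem ha, Finset.prod_range_succ, mul_comm]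
    exact mul_le_mul (hf (Nat.le_add_right _ _) ((Nat.le_add_right _ _).trans hle) hle)
      (ih fun n hn => hS n (Finset.mem_insert_of_mem hn))
      (Finset.prod_nonneg fun i _ => nonneg _ (Nat.le_add_right _ _))
      (nonneg a ((Nat.le_add_right _ _).trans hle))

theorem factorial_card_primeFactors_le {n : ℕ} (hn : n ≠ 0) :
    n.primeFactors.card.factorial ≤ n := by
  calc n.primeFactors.card.factorial
      = ∏ i ∈ Finset.range n.primeFactors.card, (1 + i) := by
        simp only [← Finset.prod_range_add_one_eq_factorial, add_comm]
    _ ≤ ∏ p ∈ n.primeFactors, p :=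
        prod_range_add_le_prod (monotone_id.monotoneOn _) zero_le_one
          fun p hp => (Nat.prime_of_mem_primeFactors hp).one_le
    _ ≤ n := Nat.le_of_dvd (Nat.pos_of_ne_zero hn) (Nat.prod_primeFactors_dvd n)

theorem card_primeFactors_mul_log_le {n : ℕ} (hn : n ≠ 0) {a : ℝ} (ha : 0 < a) :
    n.primeFactors.card * Real.log a ≤ a + Real.log n := by
  have hpow : a ^ n.primeFactors.card ≤ Real.exp a * n := by
    have hexp := Real.pow_div_factorial_le_exp a ha.le n.primeFactors.card
    rw [div_le_iff₀ (by positivity)] at hexp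
    refine hexp.trans (mul_le_mul_of_nonneg_left ?_ (Real.exp_nonneg a))
    exact_mod_cast factorial_card_primeFactors_le hn
  have hn₀ : (n : ℝ) ≠ 0 := Nat.cast_ne_zero.2 hn
  have hlog := Real.log_le_log (pow_pos ha _) hpow
  rwa [Real.log_pow, Real.log_mul (Real.exp_ne_zero a) hn₀, Real.log_exp] at hlog

theorem inv_card_primeFactors_add_one_le_totient_div (n : ℕ+) :
    ((n : ℕ).primeFactors.card + 1 : ℝ)⁻¹ ≤ (n : ℕ).totient / (n : ℕ) := by
  have htelescope (k : ℕ) : ∏ i ∈ Finset.range k, (1 - ((2 + i : ℕ) : ℝ)⁻¹) = (k + 1 : ℝ)⁻¹ := by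
    induction k with
    | zero => simp
    | succ k ih =>
      rw [Finset.prod_range_succ, ih]
      push_cast
      field_simp
      ring
  have htotient : ((n : ℕ).totient : ℝ) / (n : ℕ) =
      ∏ p ∈ (n : ℕ).primeFactors, (1 - (p : ℝ)⁻¹) := by
    have h := congrArg (fun r : ℚ => (r : ℝ)) (Nat.totient_eq_mul_prod_factors n)
    push_cast at h
    rw [h, mul_div_cancel_left₀ _ (Nat.cast_ne_zero.2 n.ne_zero)]
  have hmono : MonotoneOn (fun k : ℕ => 1 - (k : ℝ)⁻¹) (Set.Ici 2) := fun j hj k _ hjk => by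
    have hj₀ : (0 : ℝ) < j := Nat.cast_pos.2 (zero_lt_two.trans_le hj)
    dsimp only
    gcongr
  rw [htotient, ← htelescope]
  exact prod_range_add_le_prod hmono (by norm_num)
    fun p hp => (Nat.prime_of_mem_primeFactors hp).two_le

theorem tendsto_totient_div_mul_atTop {α : Type*} {l : Filter α} {q : α → ℕ+} {g : α → ℝ}
    (hg : Tendsto g l atTop) (hq : ∀ᶠ x in l, Real.log (q x : ℕ) ≤ g x) :
    Tendsto (fun x => ((q x : ℕ).totient : ℝ) / (q x : ℕ) * g x) l atTop := by
  rw [tendsto_atTop]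
  intro b
  set c := max b 1
  have hc : 0 < c := lt_max_of_lt_right one_pos
  filter_upwards [hq, hg.eventually_ge_atTop (Real.exp (2 * c) + 2 * c)] with x hqx hgx
  have hω := card_primeFactors_mul_log_le (q x).ne_zero (Real.exp_pos (2 * c))
  rw [Real.log_exp] at hω
  have hg₀ : 0 ≤ g x := le_trans (by positivity) hgx
  calc b ≤ c := le_max_left b 1
    _ ≤ ((q x : ℕ).primeFactors.card + 1 : ℝ)⁻¹ * g x := by
        rw [inv_mul_eq_div, le_div_iff₀ (by positivity)]
        linarith
    _ ≤ _ := mul_le_mul_of_nonneg_right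
        (inv_card_primeFactors_add_one_le_totient_div (q x)) hg₀

/-- The first time (counted from `1`) at which the sequence `t` visits `A`, and `⊤` if it never
does. -/
noncomputable def waitingTime {Ω : Type*} (A : Set Ω) (t : ℕ → Ω) : ℕ∞ :=
  ⨅ (k : ℕ) (_ : t k ∈ A), ((k + 1 : ℕ) : ℕ∞)

section WaitingTime

variable {Ω : Type*} {A : Set Ω}

theorem waitingTime_eq_tsum (A : Set Ω) (t : ℕ → Ω) :
    (waitingTime A t : ℝ≥0∞) =
      ∑' n : ℕ, ((Finset.range n : Set ℕ).pi fun _ => Aᶜ).indicator 1 t := by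
  classical
  by_cases h : ∃ k, t k ∈ A
  · have hfind : waitingTime A t = ((Nat.find h + 1 : ℕ) : ℕ∞) := by
      refine le_antisymm (iInf₂_le (Nat.find h) (Nat.find_spec h)) (le_iInf₂ fun k hk => ?_)
      exact_mod_cast Nat.succ_le_succ (Nat.find_min' h hk)
    have hmem (n : ℕ) : t ∈ (Finset.range n : Set ℕ).pi (fun _ => Aᶜ) ↔
        n ∈ Finset.range (Nat.find h + 1) := by
      simp [Set.mem_pi, Nat.le_find_iff]
    simp only [Set.indicator_apply, hmem, Pi.one_apply, hfind]
    rw [tsum_eq_sum fun n hn => if_neg hn, Finset.sum_ite_mem, Finset.inter_self]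
    simp
  · push Not at h
    simp [waitingTime, h]

theorem exists_mem_of_waitingTime_lt_top {t : ℕ → Ω} (h : waitingTime A t < ⊤) : ∃ k, t k ∈ A := by
  simpa [waitingTime, iInf_lt_iff] using h

variable [MeasurableSpace Ω]

theorem measurable_waitingTime (hA : MeasurableSet A) :
    Measurable fun t : ℕ → Ω => (waitingTime A t : ℝ≥0∞) := by
  simp only [waitingTime_eq_tsum]
  exact Measurable.tsum fun n => measurable_one.indicator
    (MeasurableSet.pi (Finset.countable_toSet _) fun _ _ => hA.compl)

theorem lintegral_waitingTime_infinitePi (μ : Measure Ω) [IsProbabilityMeasure μ]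
    (hA : MeasurableSet A) :
    ∫⁻ t, (waitingTime A t : ℝ≥0∞) ∂(Measure.infinitePi fun _ : ℕ => μ) = (μ A)⁻¹ := by
  have hpi (n : ℕ) : MeasurableSet ((Finset.range n : Set ℕ).pi fun _ => Aᶜ) :=
    MeasurableSet.pi (Finset.countable_toSet _) fun _ _ => hA.compl
  simp only [waitingTime_eq_tsum]
  rw [lintegral_tsum fun n => (measurable_one.indicator (hpi n)).aemeasurable]
  simp only [lintegral_indicator_one (hpi _), Measure.infinitePi_pi _ fun _ _ => hA.compl,
    Finset.prod_const, Finset.card_range]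
  rw [ENNReal.tsum_geometric, ← prob_compl_eq_one_sub hA.compl, compl_compl]

end WaitingTime

namespace PrimeGen

theorem iterations_eq_waitingTime (q : ℕ+) (ω : Run) :
    iterations q ω = waitingTime {p | p.Prime} (candidate q ω) := rfl

theorem iterations_mk_eq_waitingTime (q : ℕ+) (a : ℕ) (t : ℕ → ℕ) :
    iterations q (a, t) = waitingTime {s | (a + s * q).Prime} t := rfl

theorem measurable_iterations (q : ℕ+) : Measurable fun ω : Run => (iterations q ω : ℝ≥0∞) := by
  have hcandidate : Measurable fun ω : Run => candidate q ω :=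
    measurable_pi_lambda _ fun k => by
      unfold candidate
      fun_prop
  exact (measurable_waitingTime MeasurableSet.of_discrete).comp hcandidate

theorem measurable_randomBits (x : ℝ) (q : ℕ+) : Measurable (randomBits x q) :=
  measurable_const.add ((measurable_iterations q).mul
    ((measurable_from_nat (f := fun a => drawBits (tRange x q a))).comp measurable_fst))

section

variable {x : ℝ} {q : ℕ+} {a : ℕ}

theorem lt_of_mem_unitReps (ha : a ∈ unitReps q) : a < q :=
  Finset.mem_range.1 (Finset.mem_filter.1 ha).1

theorem coprime_of_mem_unitReps (ha : a ∈ unitReps q) : a.Coprime q :=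
  (Finset.mem_filter.1 ha).2.symm

theorem mem_tRange_iff (hax : (a : ℝ) ≤ x) (t : ℕ) : t ∈ tRange x q a ↔ a + t * q ≤ ⌊x⌋₊ := by
  have hq₀ : (0 : ℝ) < (q : ℕ) := Nat.cast_pos.2 q.pos
  rw [tRange, Finset.mem_range, Nat.lt_succ_iff,
    Nat.le_floor_iff (div_nonneg (sub_nonneg.2 hax) hq₀.le),
    Nat.le_floor_iff ((Nat.cast_nonneg a).trans hax), le_div_iff₀ hq₀, le_sub_iff_add_le']
  push_cast
  rfl

theorem card_filter_prime_tRange (hqx : ((q : ℕ) : ℝ) ≤ x) (ha : a ∈ unitReps q) :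
    ((tRange x q a).filter fun t => (a + t * q).Prime).card = primeCountingAP x q a := by
  have haq := lt_of_mem_unitReps ha
  have hmem := mem_tRange_iff (q := q) ((Nat.cast_le.2 haq.le).trans hqx)
  have hdiv (t : ℕ) : (a + t * q) / q = t := by
    rw [Nat.add_mul_div_right _ _ q.pos, Nat.div_eq_of_lt haq, zero_add]
  have hmod {p : ℕ} (hp : p ≡ a [MOD q]) : a + p / q * q = p := by
    rw [← Nat.mod_eq_of_lt haq, ← hp, Nat.mod_add_div']
  refine Finset.card_nbij' (fun t => a + t * q) (fun p => p / q) (fun t ht => ?_) (fun p hp => ?_)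
    (fun t _ => hdiv t) fun p hp => ?_
  · simp only [Finset.coe_filter, Set.mem_ofPred_eq, hmem, Finset.mem_range] at ht ⊢
    exact ⟨Nat.lt_succ_of_le ht.1, ht.2, by simp [Nat.ModEq]⟩
  · simp only [Finset.coe_filter, Set.mem_ofPred_eq, hmem, Finset.mem_range] at hp ⊢
    rw [hmod hp.2.2]
    exact ⟨Nat.le_of_lt_succ hp.1, hp.2.1⟩
  · exact hmod (Finset.mem_filter.1 hp).2.2

theorem lintegral_iterations_loopLaw (hqx : ((q : ℕ) : ℝ) ≤ x) (ha : a ∈ unitReps q) :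
    ∫⁻ t, (iterations q (a, t) : ℝ≥0∞) ∂(loopLaw x q a) =
      (tRange x q a).card / primeCountingAP x q a := by
  have hloop : loopLaw x q a = Measure.infinitePi fun _ : ℕ =>
    (PMF.uniformOfFinset (tRange x q a) (tRange_nonempty x q a)).toMeasure := rfl
  simp only [iterations_mk_eq_waitingTime]
  rw [hloop, lintegral_waitingTime_infinitePi _ MeasurableSet.of_discrete,
    PMF.toMeasure_uniformOfFinset_apply _ _ MeasurableSet.of_discrete,
    ← card_filter_prime_tRange hqx ha, ENNReal.inv_div (Or.inl (ENNReal.natCast_ne_top _))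
      (Or.inl (Nat.cast_ne_zero.2 (Finset.card_ne_zero.2 (tRange_nonempty x q a))))]
  simp only [Set.mem_ofPred_eq]

theorem lintegral_randomBits_loopLaw (hqx : ((q : ℕ) : ℝ) ≤ x) (ha : a ∈ unitReps q) :
    ∫⁻ t, randomBits x q (a, t) ∂(loopLaw x q a) = drawBits (unitReps q) +
      (tRange x q a).card / primeCountingAP x q a * drawBits (tRange x q a) := by
  have hmeas : Measurable fun t : ℕ → ℕ => (iterations q (a, t) : ℝ≥0∞) :=
    (measurable_iterations q).comp measurable_prodMk_left
  simp only [randomBits]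
  rw [lintegral_add_left measurable_const, lintegral_const, measure_univ, mul_one,
    lintegral_mul_const _ hmeas, lintegral_iterations_loopLaw hqx ha]

theorem ae_mem_unitReps (q : ℕ+) : ∀ᵐ a ∂(residueLaw q), a ∈ unitReps q := by
  rw [residueLaw, ae_iff, PMF.toMeasure_uniformOfFinset_apply _ _ MeasurableSet.of_discrete]
  simp

theorem lintegral_runLaw_mem_Icc {f : Run → ℝ≥0∞} (hf : Measurable f) {A B : ℝ≥0∞}
    (h : ∀ a ∈ unitReps q, ∫⁻ t, f (a, t) ∂(loopLaw x q a) ∈ Set.Icc A B) :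
    ∫⁻ ω, f ω ∂(runLaw x q) ∈ Set.Icc A B := by
  rw [runLaw, Measure.lintegral_compProd hf]
  constructor
  · calc A = ∫⁻ _, A ∂(residueLaw q) := by simp
      _ ≤ _ := lintegral_mono_ae ((ae_mem_unitReps q).mono fun a ha => (h a ha).1)
  · calc _ ≤ ∫⁻ _, B ∂(residueLaw q) :=
          lintegral_mono_ae ((ae_mem_unitReps q).mono fun a ha => (h a ha).2)
      _ = B := by simp

theorem ae_terminates_of_lintegral_iterations_ne_top
    (h : ∫⁻ ω, (iterations q ω : ℝ≥0∞) ∂(runLaw x q) ≠ ⊤) :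
    ∀ᵐ ω ∂(runLaw x q), Terminates q ω := by
  filter_upwards [ae_lt_top (measurable_iterations q) h] with ω hω
  rw [iterations_eq_waitingTime] at hω
  exact exists_mem_of_waitingTime_lt_top (ENat.toENNReal_lt_top.1 hω)

end

end PrimeGen

theorem tendsto_log_div_log_of_isTheta_rpow {f : ℝ → ℝ} {s : ℝ}
    (hf : f =Θ[atTop] fun x : ℝ => x ^ s) :
    Tendsto (fun x => Real.log (f x) / Real.log x) atTop (𝓝 s) := by
  obtain ⟨C, hC, hupper⟩ := hf.1.exists_pos
  obtain ⟨c, hc, hlower⟩ := hf.2.exists_pos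
  have hlim (b : ℝ) : Tendsto (fun x : ℝ => b / Real.log x + s) atTop (𝓝 s) := by
    simpa using (Real.tendsto_log_atTop.const_div_atTop b).add_const s
  refine tendsto_of_tendsto_of_tendsto_of_le_of_le' (hlim (-Real.log c)) (hlim (Real.log C)) ?_ ?_
  all_goals
    filter_upwards [hupper.bound, hlower.bound, eventually_gt_atTop 1] with x hle hge hx
    have hx₀ : 0 < x := zero_lt_one.trans hx
    have hpow : 0 < x ^ s := Real.rpow_pos_of_pos hx₀ s
    rw [Real.norm_of_nonneg hpow.le, Real.norm_eq_abs] at hle hge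
    have hf₀ : 0 < |f x| := pos_of_mul_pos_right (hpow.trans_le hge) hc.le
    rw [div_add' _ _ _ (Real.log_pos hx).ne', div_le_div_iff_of_pos_right (Real.log_pos hx),
      ← Real.log_rpow hx₀, ← Real.log_abs (f x)]
  · rw [neg_add_le_iff_le_add, ← Real.log_mul hc.ne' hf₀.ne']
    exact Real.log_le_log hpow hge
  · rw [← Real.log_mul hC.ne' hpow.ne']
    exact Real.log_le_log hf₀ hle

theorem exists_tendsto_zero_eq_ofReal_mul {ι : Type*} {l : Filter ι} {V : ι → ℝ≥0∞} {m : ι → ℝ}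
    {c : ℝ} (hc : 0 ≤ c) (hm : ∀ᶠ i in l, 0 < m i)
    (h : ∀ η > 0, ∀ᶠ i in l,
      V i ∈ Set.Icc (ENNReal.ofReal ((c - η) * m i)) (ENNReal.ofReal ((c + η) * m i))) :
    ∃ δ : ι → ℝ, Tendsto δ l (𝓝 0) ∧ ∀ᶠ i in l, V i = ENNReal.ofReal ((c + δ i) * m i) := by
  refine ⟨fun i => (V i).toReal / m i - c, ?_, ?_⟩
  · rw [Metric.tendsto_nhds]
    intro η hη
    filter_upwards [hm, h (η / 2) (half_pos hη)] with i hi ⟨hlower, hupper⟩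
    have hV : V i ≠ ⊤ := ne_top_of_le_ne_top ENNReal.ofReal_ne_top hupper
    have hle := (ENNReal.ofReal_le_iff_le_toReal hV).1 hlower
    have hge := ENNReal.toReal_le_of_le_ofReal (by positivity) hupper
    rw [← le_div_iff₀ hi] at hle
    rw [← div_le_iff₀ hi] at hge
    rw [Real.dist_eq, sub_zero, abs_lt]
    constructor <;> linarith
  · filter_upwards [hm, h 1 one_pos] with i hi ⟨_, hupper⟩
    have hV : V i ≠ ⊤ := ne_top_of_le_ne_top ENNReal.ofReal_ne_top hupper
    rw [add_sub_cancel, div_mul_cancel₀ _ hi.ne', ENNReal.ofReal_toReal hV]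

namespace PrimeGen

/-- The filter on pairs `(x, a)` expressing that `x → ∞`, uniformly in the invertible class `a`
modulo `q x`. -/
def residueFilter (q : ℝ → ℕ+) : Filter (ℝ × ℕ) :=
  comap Prod.fst atTop ⊓ 𝓟 {p | p.2 ∈ unitReps (q p.1)}

section

variable {q : ℝ → ℕ+}

theorem eventually_residueFilter {P : ℝ × ℕ → Prop} :
    (∀ᶠ p in residueFilter q, P p) ↔ ∀ᶠ x in atTop, ∀ a ∈ unitReps (q x), P (x, a) := by
  rw [residueFilter, eventually_inf_principal, eventually_comap]
  refine eventually_congr (Eventually.of_forall fun x => ⟨fun h a => h (x, a) rfl, ?_⟩)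
  rintro h ⟨_, a⟩ rfl
  exact h a

theorem tendsto_fst_residueFilter : Tendsto Prod.fst (residueFilter q) atTop :=
  tendsto_comap.mono_left inf_le_left

theorem eventually_mem_unitReps : ∀ᶠ p in residueFilter q, p.2 ∈ unitReps (q p.1) :=
  eventually_residueFilter.2 (Eventually.of_forall fun _ _ ha => ha)

theorem exists_tendsto_lintegral_runLaw_eq {f : ℝ → Run → ℝ≥0∞} (hf : ∀ x, Measurable (f x))
    {r : ℝ × ℕ → ℝ} {m : ℝ → ℝ} {c : ℝ} (hc : 0 ≤ c) (hm : ∀ᶠ x in atTop, 0 < m x)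
    (hr : ∀ᶠ p in residueFilter q,
      ∫⁻ t, f p.1 (p.2, t) ∂(loopLaw p.1 (q p.1) p.2) = ENNReal.ofReal (r p))
    (hlim : Tendsto (fun p => r p / m p.1) (residueFilter q) (𝓝 c)) :
    ∃ δ : ℝ → ℝ, Tendsto δ atTop (𝓝 0) ∧ ∀ᶠ x : ℝ in atTop,
      ∫⁻ ω, f x ω ∂(runLaw x (q x)) = ENNReal.ofReal ((c + δ x) * m x) := by
  refine exists_tendsto_zero_eq_ofReal_mul hc hm fun η hη => ?_
  have hclose := hlim.eventually (Icc_mem_nhds (sub_lt_self c hη) (lt_add_of_pos_right c hη))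
  filter_upwards [hm, eventually_residueFilter.1 (hr.and hclose)] with x hmx hx
  refine lintegral_runLaw_mem_Icc (hf x) fun a ha => ?_
  obtain ⟨heq, hlower, hupper⟩ := hx a ha
  rw [heq]
  exact ⟨ENNReal.ofReal_le_ofReal ((le_div_iff₀ hmx).1 hlower),
    ENNReal.ofReal_le_ofReal ((div_le_iff₀ hmx).1 hupper)⟩

theorem abs_card_tRange_sub_le_one {x : ℝ} {n : ℕ+} {a : ℕ} (hnx : ((n : ℕ) : ℝ) ≤ x)
    (ha : a ∈ unitReps n) : |((tRange x n a).card : ℝ) - x / (n : ℕ)| ≤ 1 := by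
  have hn₀ : (0 : ℝ) < (n : ℕ) := Nat.cast_pos.2 n.pos
  have han : (a : ℝ) ≤ (n : ℕ) := Nat.cast_le.2 (lt_of_mem_unitReps ha).le
  have hfloor := Nat.floor_le (div_nonneg (sub_nonneg.2 (han.trans hnx)) hn₀.le)
  have hlt := Nat.lt_floor_add_one ((x - a) / (n : ℕ))
  have hdiv₀ : 0 ≤ (a : ℝ) / (n : ℕ) := by positivity
  have hdiv₁ : (a : ℝ) / (n : ℕ) ≤ 1 := (div_le_one hn₀).2 han
  rw [sub_div] at hfloor hlt
  rw [tRange, Finset.card_range, Nat.cast_add_one, abs_le, sub_div]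
  constructor <;> linarith

theorem tendsto_card_tRange_div (hq : Tendsto (fun x : ℝ => x / (q x : ℕ)) atTop atTop) :
    Tendsto (fun p : ℝ × ℕ => ((tRange p.1 (q p.1) p.2).card : ℝ) / (p.1 / (q p.1 : ℕ)))
      (residueFilter q) (𝓝 1) := by
  have hX := hq.comp (tendsto_fst_residueFilter (q := q))
  rw [tendsto_iff_norm_sub_tendsto_zero]
  refine squeeze_zero' (Eventually.of_forall fun _ => norm_nonneg _) ?_ (hX.const_div_atTop 1)
  filter_upwards [eventually_mem_unitReps, hX.eventually_ge_atTop 1] with ⟨x, a⟩ ha hx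
  dsimp only [Function.comp_apply] at ha hx ⊢
  have hX₀ : 0 < x / (q x : ℕ) := one_pos.trans_le hx
  have hqx : ((q x : ℕ) : ℝ) ≤ x := (one_le_div₀ (Nat.cast_pos.2 (q x).pos)).1 hx
  rw [div_sub_one hX₀.ne', norm_div, Real.norm_eq_abs, Real.norm_of_nonneg hX₀.le]
  exact div_le_div_of_nonneg_right (abs_card_tRange_sub_le_one hqx ha) hX₀.le

theorem lt_of_rpow_le_div {δ x : ℝ} {n : ℕ+} (hδ : 0 < δ) (hx : 1 < x)
    (h : x ^ δ ≤ x / (n : ℕ)) : ((n : ℕ) : ℝ) < x :=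
  (one_lt_div₀ (Nat.cast_pos.2 n.pos)).1 ((Real.one_lt_rpow hx hδ).trans_le h)

theorem abs_primeCountingAP_sub_mul_le {C δ x : ℝ} {n a : ℕ} (hn : 0 < n) (hx : 1 < x)
    (hnx : x ^ δ ≤ x / n)
    (hFGM : |(primeCountingAP x n a : ℝ) - (Nat.primeCounting ⌊x⌋₊ : ℝ) / (Nat.totient n : ℝ)|
      ≤ C * (x / n) ^ (1 / 2 : ℝ) * x ^ (δ / 4)) :
    |(primeCountingAP x n a : ℝ) * n.totient * Real.log x / x -
        (Nat.primeCounting ⌊x⌋₊ : ℝ) * Real.log x / x| ≤ |C| * (Real.log x / x ^ (δ / 4)) := by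
  have hx₀ : 0 < x := zero_lt_one.trans hx
  have hlog := Real.log_pos hx
  have hφn : (n.totient : ℝ) ≤ n := Nat.cast_le.2 (Nat.totient_le n)
  have hX₀ : 0 < x / n := by positivity
  have hfactor : (primeCountingAP x n a : ℝ) * n.totient * Real.log x / x -
      (Nat.primeCounting ⌊x⌋₊ : ℝ) * Real.log x / x =
      ((primeCountingAP x n a : ℝ) - (Nat.primeCounting ⌊x⌋₊ : ℝ) / (n.totient : ℝ)) *
        (n.totient * Real.log x / x) := by
    field_simp
  have hhalf : (x / n) ^ (1 / 2 : ℝ) * (n / x) = (x / n) ^ (-(1 / 2) : ℝ) := by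
    rw [← inv_div x, ← Real.rpow_neg_one, ← Real.rpow_add hX₀]
    norm_num
  have hX : (x / n) ^ (-(1 / 2) : ℝ) ≤ (x ^ δ) ^ (-(1 / 2) : ℝ) :=
    Real.rpow_le_rpow_of_nonpos (by positivity) hnx (by norm_num)
  have hpow : (x ^ δ) ^ (-(1 / 2) : ℝ) * x ^ (δ / 4) = (x ^ (δ / 4))⁻¹ := by
    rw [← Real.rpow_mul hx₀.le, ← Real.rpow_add hx₀, ← Real.rpow_neg hx₀.le]
    ring_nf
  rw [hfactor, abs_mul, abs_of_nonneg (a := _ * _ / _) (by positivity)]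
  calc _ ≤ |C| * (x / n) ^ (1 / 2 : ℝ) * x ^ (δ / 4) * (n * Real.log x / x) := by
        refine mul_le_mul (hFGM.trans ?_) (by gcongr) (by positivity) (by positivity)
        gcongr
        exact le_abs_self C
    _ = |C| * ((x / n) ^ (-(1 / 2) : ℝ) * x ^ (δ / 4)) * Real.log x := by
        rw [← hhalf]
        ring
    _ ≤ |C| * ((x ^ δ) ^ (-(1 / 2) : ℝ) * x ^ (δ / 4)) * Real.log x := by gcongr
    _ = |C| * (Real.log x / x ^ (δ / 4)) := by
        rw [hpow]
        ring

variable {δ : ℝ}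

theorem eventually_lt_self_of_rpow_le_div (hδ : 0 < δ)
    (hq : ∀ᶠ x : ℝ in atTop, x ^ δ ≤ x / (q x : ℕ)) : ∀ᶠ x : ℝ in atTop, ((q x : ℕ) : ℝ) < x := by
  filter_upwards [hq, eventually_gt_atTop 1] with x hqx hx using lt_of_rpow_le_div hδ hx hqx

theorem tendsto_primeCountingAP_mul_totient_mul_log_div (hFGM : FriedlanderGranvilleMontgomery)
    (hδ : 0 < δ) (hq : ∀ᶠ x : ℝ in atTop, x ^ δ ≤ x / (q x : ℕ)) :
    Tendsto (fun p : ℝ × ℕ => (primeCountingAP p.1 (q p.1) p.2 : ℝ) * (q p.1 : ℕ).totient *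
      Real.log p.1 / p.1) (residueFilter q) (𝓝 1) := by
  have hδ₄ : 0 < δ / 4 := by positivity
  obtain ⟨C, hC⟩ := hFGM (δ / 4) hδ₄
  have hfst := tendsto_fst_residueFilter (q := q)
  have herror : Tendsto (fun x : ℝ => |C| * (Real.log x / x ^ (δ / 4))) atTop (𝓝 0) := by
    simpa using (isLittleO_log_rpow_atTop hδ₄).tendsto_div_nhds_zero.const_mul |C|
  have hdiff : Tendsto (fun p : ℝ × ℕ =>
      (primeCountingAP p.1 (q p.1) p.2 : ℝ) * (q p.1 : ℕ).totient * Real.log p.1 / p.1 -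
        (Nat.primeCounting ⌊p.1⌋₊ : ℝ) * Real.log p.1 / p.1) (residueFilter q) (𝓝 0) := by
    refine squeeze_zero_norm' ?_ (herror.comp hfst)
    filter_upwards [eventually_mem_unitReps, hfst.eventually hq,
      hfst.eventually (eventually_gt_atTop 1)] with ⟨x, a⟩ ha hqx hx
    exact abs_primeCountingAP_sub_mul_le (q x).pos hx hqx
      (hC x (q x) a (q x).pos (lt_of_rpow_le_div hδ hx hqx) (coprime_of_mem_unitReps ha))
  simpa using hdiff.add (tendsto_primeCounting_mul_log_div.comp hfst)

theorem eventually_primeCountingAP_pos (hFGM : FriedlanderGranvilleMontgomery)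
    (hδ : 0 < δ) (hq : ∀ᶠ x : ℝ in atTop, x ^ δ ≤ x / (q x : ℕ)) :
    ∀ᶠ p in residueFilter q, 0 < primeCountingAP p.1 (q p.1) p.2 := by
  filter_upwards [(tendsto_primeCountingAP_mul_totient_mul_log_div hFGM hδ hq).eventually_const_lt
    zero_lt_one] with p hp
  refine Nat.pos_of_ne_zero fun h => ?_
  simp [h] at hp

theorem tendsto_card_tRange_div_primeCountingAP_div (hFGM : FriedlanderGranvilleMontgomery)
    (hδ : 0 < δ) (hq : ∀ᶠ x : ℝ in atTop, x ^ δ ≤ x / (q x : ℕ)) :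
    Tendsto (fun p : ℝ × ℕ =>
      ((tRange p.1 (q p.1) p.2).card : ℝ) / primeCountingAP p.1 (q p.1) p.2 /
        (((q p.1 : ℕ).totient : ℝ) / (q p.1 : ℕ) * Real.log p.1)) (residueFilter q) (𝓝 1) := by
  have hX : Tendsto (fun x : ℝ => x / (q x : ℕ)) atTop atTop :=
    tendsto_atTop_mono' _ hq (tendsto_rpow_atTop hδ)
  have hratio := (tendsto_card_tRange_div hX).div
    (tendsto_primeCountingAP_mul_totient_mul_log_div hFGM hδ hq) one_ne_zero
  rw [div_one] at hratio
  refine hratio.congr' ?_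
  filter_upwards [tendsto_fst_residueFilter.eventually (eventually_gt_atTop 0)] with p hp
  simp only [Pi.div_apply]
  field_simp

theorem exists_tendsto_lintegral_iterations_eq (hFGM : FriedlanderGranvilleMontgomery)
    (hδ : 0 < δ) (hq : ∀ᶠ x : ℝ in atTop, x ^ δ ≤ x / (q x : ℕ)) :
    ∃ η : ℝ → ℝ, Tendsto η atTop (𝓝 0) ∧ ∀ᶠ x : ℝ in atTop,
      ∫⁻ ω, (iterations (q x) ω : ℝ≥0∞) ∂(runLaw x (q x)) =
        ENNReal.ofReal ((1 + η x) * (((q x : ℕ).totient : ℝ) / (q x : ℕ) * Real.log x)) := by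
  have hlt := eventually_lt_self_of_rpow_le_div hδ hq
  refine exists_tendsto_lintegral_runLaw_eq (fun x => measurable_iterations (q x)) zero_le_one ?_ ?_
    (tendsto_card_tRange_div_primeCountingAP_div hFGM hδ hq)
  · filter_upwards [eventually_gt_atTop 1] with x hx
    have hlog := Real.log_pos hx
    positivity
  · filter_upwards [eventually_mem_unitReps, eventually_primeCountingAP_pos hFGM hδ hq,
      tendsto_fst_residueFilter.eventually hlt] with p hmem hpos hqx
    rw [lintegral_iterations_loopLaw hqx.le hmem, ENNReal.ofReal_div_of_pos (Nat.cast_pos.2 hpos),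
      ENNReal.ofReal_natCast, ENNReal.ofReal_natCast]

end

end PrimeGen

namespace PrimeGen

section

variable {q : ℝ → ℕ+} {ε : ℝ}

theorem tendsto_log_div_div_log
    (hq : Tendsto (fun x : ℝ => Real.log (q x : ℕ) / Real.log x) atTop (𝓝 (1 - ε))) :
    Tendsto (fun x : ℝ => Real.log (x / (q x : ℕ)) / Real.log x) atTop (𝓝 ε) := by
  have hsub := hq.const_sub 1
  rw [sub_sub_cancel] at hsub
  refine hsub.congr' ?_
  filter_upwards [eventually_gt_atTop 1] with x hx
  rw [Real.log_div (zero_lt_one.trans hx).ne' (Nat.cast_ne_zero.2 (q x).ne_zero), sub_div,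
    div_self (Real.log_pos hx).ne']

theorem eventually_rpow_le_div {δ : ℝ} (hδ : δ < ε)
    (hq : Tendsto (fun x : ℝ => Real.log (q x : ℕ) / Real.log x) atTop (𝓝 (1 - ε))) :
    ∀ᶠ x : ℝ in atTop, x ^ δ ≤ x / (q x : ℕ) := by
  filter_upwards [(tendsto_log_div_div_log hq).eventually_const_lt hδ, eventually_gt_atTop 1]
    with x hlt hx
  have hx₀ : 0 < x := zero_lt_one.trans hx
  rw [lt_div_iff₀ (Real.log_pos hx), ← Real.log_rpow hx₀] at hlt
  have hX₀ : 0 < x / (q x : ℕ) := div_pos hx₀ (Nat.cast_pos.2 (q x).pos)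
  exact ((Real.log_lt_log_iff (Real.rpow_pos_of_pos hx₀ δ) hX₀).1 hlt).le

theorem tendsto_div_atTop (hε : 0 < ε)
    (hq : Tendsto (fun x : ℝ => Real.log (q x : ℕ) / Real.log x) atTop (𝓝 (1 - ε))) :
    Tendsto (fun x : ℝ => x / (q x : ℕ)) atTop atTop :=
  tendsto_atTop_mono' _ (eventually_rpow_le_div (half_lt_self hε) hq)
    (tendsto_rpow_atTop (half_pos hε))

theorem tendsto_log_card_tRange_div_log (hε : 0 < ε)
    (hq : Tendsto (fun x : ℝ => Real.log (q x : ℕ) / Real.log x) atTop (𝓝 (1 - ε))) :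
    Tendsto (fun p : ℝ × ℕ => Real.log (tRange p.1 (q p.1) p.2).card / Real.log p.1)
      (residueFilter q) (𝓝 ε) := by
  have hX := tendsto_div_atTop hε hq
  have hfst := tendsto_fst_residueFilter (q := q)
  have hlog := (tendsto_card_tRange_div hX).log one_ne_zero
  rw [Real.log_one] at hlog
  have hsum := (hlog.div_atTop (Real.tendsto_log_atTop.comp hfst)).add
    ((tendsto_log_div_div_log hq).comp hfst)
  rw [zero_add] at hsum
  refine hsum.congr' ?_
  filter_upwards [hfst.eventually (hX.eventually_gt_atTop 0)] with p hp
  have hcard : ((tRange p.1 (q p.1) p.2).card : ℝ) ≠ 0 :=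
    Nat.cast_ne_zero.2 (Finset.card_ne_zero.2 (tRange_nonempty _ _ _))
  simp only [Function.comp_apply]
  rw [← add_div, Real.log_div hcard hp.ne', sub_add_cancel]

theorem tendsto_logb_card_unitReps_div (hq : ∀ᶠ x : ℝ in atTop, ((q x : ℕ) : ℝ) ≤ x) :
    Tendsto (fun x : ℝ => Real.logb 2 (unitReps (q x)).card /
      (((q x : ℕ).totient : ℝ) / (q x : ℕ) * (Real.log x ^ 2 / Real.log 2))) atTop (𝓝 0) := by
  have hmain : Tendsto (fun x : ℝ => ((q x : ℕ).totient : ℝ) / (q x : ℕ) * Real.log x)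
      atTop atTop :=
    tendsto_totient_div_mul_atTop Real.tendsto_log_atTop
      (hq.mono fun x hx => Real.log_le_log (Nat.cast_pos.2 (q x).pos) hx)
  refine squeeze_zero_norm' ?_ (hmain.const_div_atTop 1)
  filter_upwards [hq, eventually_gt_atTop 1] with x hqx hx
  have hlog := Real.log_pos hx
  have hφ : 0 < (q x : ℕ).totient := Nat.totient_pos.2 (q x).pos
  have hφq : ((q x : ℕ).totient : ℝ) ≤ (q x : ℕ) := Nat.cast_le.2 (Nat.totient_le _)
  have hle : Real.log (q x : ℕ).totient ≤ Real.log x :=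
    Real.log_le_log (Nat.cast_pos.2 hφ) (hφq.trans hqx)
  have hcard : (unitReps (q x)).card = (q x : ℕ).totient := rfl
  rw [hcard, Real.logb, Real.norm_of_nonneg (by positivity)]
  calc _ = Real.log (q x : ℕ).totient / Real.log x /
        (((q x : ℕ).totient : ℝ) / (q x : ℕ) * Real.log x) := by field_simp
    _ ≤ _ := by
        gcongr
        exact (div_le_one hlog).2 hle

theorem tendsto_expected_bits_div (hFGM : FriedlanderGranvilleMontgomery) (hε : 0 < ε)
    (hq : Tendsto (fun x : ℝ => Real.log (q x : ℕ) / Real.log x) atTop (𝓝 (1 - ε))) :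
    Tendsto (fun p : ℝ × ℕ => (Real.logb 2 (unitReps (q p.1)).card +
      ((tRange p.1 (q p.1) p.2).card : ℝ) / primeCountingAP p.1 (q p.1) p.2 *
        Real.logb 2 (tRange p.1 (q p.1) p.2).card) /
      (((q p.1 : ℕ).totient : ℝ) / (q p.1 : ℕ) * (Real.log p.1 ^ 2 / Real.log 2)))
      (residueFilter q) (𝓝 ε) := by
  have hδ := half_pos hε
  have hrpow := eventually_rpow_le_div (half_lt_self hε) hq
  have hle := (eventually_lt_self_of_rpow_le_div hδ hrpow).mono fun x hx => hx.le
  have hfst := tendsto_fst_residueFilter (q := q)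
  have hsum := ((tendsto_logb_card_unitReps_div hle).comp hfst).add
    ((tendsto_card_tRange_div_primeCountingAP_div hFGM hδ hrpow).mul
      (tendsto_log_card_tRange_div_log hε hq))
  rw [one_mul, zero_add] at hsum
  refine hsum.congr' ?_
  filter_upwards [hfst.eventually (eventually_gt_atTop 1)] with p hp
  have hlog := Real.log_pos hp
  have hφ : 0 < (q p.1 : ℕ).totient := Nat.totient_pos.2 (q p.1).pos
  simp only [Function.comp_apply, Real.logb]
  field_simp

theorem exists_tendsto_lintegral_randomBits_eq (hFGM : FriedlanderGranvilleMontgomery) (hε : 0 < ε)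
    (hq : Tendsto (fun x : ℝ => Real.log (q x : ℕ) / Real.log x) atTop (𝓝 (1 - ε))) :
    ∃ η : ℝ → ℝ, Tendsto η atTop (𝓝 0) ∧ ∀ᶠ x : ℝ in atTop,
      ∫⁻ ω, randomBits x (q x) ω ∂(runLaw x (q x)) =
        ENNReal.ofReal ((ε + η x) *
          (((q x : ℕ).totient : ℝ) / (q x : ℕ) * (Real.log x ^ 2 / Real.log 2))) := by
  have hδ := half_pos hε
  have hrpow := eventually_rpow_le_div (half_lt_self hε) hq
  refine exists_tendsto_lintegral_runLaw_eq (fun x => measurable_randomBits x (q x)) hε.le ?_ ?_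
    (tendsto_expected_bits_div hFGM hε hq)
  · filter_upwards [eventually_gt_atTop 1] with x hx
    have hlog := Real.log_pos hx
    positivity
  · filter_upwards [eventually_mem_unitReps, eventually_primeCountingAP_pos hFGM hδ hrpow,
      tendsto_fst_residueFilter.eventually (eventually_lt_self_of_rpow_le_div hδ hrpow)]
      with p hmem hpos hqx
    have hlogb {S : Finset ℕ} (hS : S.Nonempty) : 0 ≤ Real.logb 2 S.card :=
      Real.logb_nonneg one_lt_two (Nat.one_le_cast.2 hS.card_pos)
    have hunits := hlogb (unitReps_nonempty (q p.1))
    have hrange := hlogb (tRange_nonempty p.1 (q p.1) p.2)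
    rw [lintegral_randomBits_loopLaw hqx.le hmem, drawBits, drawBits,
      ENNReal.ofReal_add hunits (by positivity), ENNReal.ofReal_mul (by positivity),
      ENNReal.ofReal_div_of_pos (Nat.cast_pos.2 hpos), ENNReal.ofReal_natCast,
      ENNReal.ofReal_natCast]

end

end PrimeGen

theorem mainTheorem8_general (hFGM : PrimeGen.FriedlanderGranvilleMontgomery)
    (ε : ℝ) (hε₀ : 0 < ε) (q : ℝ → ℕ+)
    (hq : Tendsto (fun x : ℝ => Real.log ((q x : ℕ) : ℝ) / Real.log x) atTop (𝓝 (1 - ε))) :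
    (∀ᶠ x : ℝ in atTop, ∀ᵐ ω ∂(PrimeGen.runLaw x (q x)), PrimeGen.Terminates (q x) ω) ∧
    (∃ δ : ℝ → ℝ, Tendsto δ atTop (𝓝 0) ∧ ∀ᶠ x : ℝ in atTop,
      ∫⁻ ω, (PrimeGen.iterations (q x) ω : ℝ≥0∞) ∂(PrimeGen.runLaw x (q x)) =
        ENNReal.ofReal
          ((1 + δ x) * ((Nat.totient (q x) : ℝ) / ((q x : ℕ) : ℝ)) * Real.log x)) ∧
    (∃ δ : ℝ → ℝ, Tendsto δ atTop (𝓝 0) ∧ ∀ᶠ x : ℝ in atTop,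
      ∫⁻ ω, PrimeGen.randomBits x (q x) ω ∂(PrimeGen.runLaw x (q x)) =
        ENNReal.ofReal
          ((ε + δ x) * ((Nat.totient (q x) : ℝ) / ((q x : ℕ) : ℝ)) *
            ((Real.log x) ^ 2 / Real.log 2))) := by
  have hiterations := PrimeGen.exists_tendsto_lintegral_iterations_eq hFGM (half_pos hε₀)
    (PrimeGen.eventually_rpow_le_div (half_lt_self hε₀) hq)
  simp only [mul_assoc]
  refine ⟨?_, hiterations, PrimeGen.exists_tendsto_lintegral_randomBits_eq hFGM hε₀ hq⟩
  obtain ⟨_, -, hexpectation⟩ := hiterations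
  filter_upwards [hexpectation] with x hx
  exact PrimeGen.ae_terminates_of_lintegral_iterations_ne_top (hx ▸ ENNReal.ofReal_ne_top)

theorem mainTheorem8 (hFGM : PrimeGen.FriedlanderGranvilleMontgomery)
    (ε : ℝ) (hε₀ : 0 < ε) (hε₁ : ε < 1)
    (q : ℝ → ℕ+) (hq : (fun x : ℝ => ((q x : ℕ) : ℝ)) =Θ[atTop] fun x : ℝ => x ^ (1 - ε)) :
    (∀ᶠ x : ℝ in atTop, ∀ᵐ ω ∂(PrimeGen.runLaw x (q x)), PrimeGen.Terminates (q x) ω) ∧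
    (∃ δ : ℝ → ℝ, Tendsto δ atTop (𝓝 0) ∧ ∀ᶠ x : ℝ in atTop,
      ∫⁻ ω, (PrimeGen.iterations (q x) ω : ℝ≥0∞) ∂(PrimeGen.runLaw x (q x)) =
        ENNReal.ofReal
          ((1 + δ x) * ((Nat.totient (q x) : ℝ) / ((q x : ℕ) : ℝ)) * Real.log x)) ∧
    (∃ δ : ℝ → ℝ, Tendsto δ atTop (𝓝 0) ∧ ∀ᶠ x : ℝ in atTop,
      ∫⁻ ω, PrimeGen.randomBits x (q x) ω ∂(PrimeGen.runLaw x (q x)) =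
        ENNReal.ofReal
          ((ε + δ x) * ((Nat.totient (q x) : ℝ) / ((q x : ℕ) : ℝ)) *
            ((Real.log x) ^ 2 / Real.log 2))) := by
  exact mainTheorem8_general hFGM ε hε₀ q (tendsto_log_div_log_of_isTheta_rpow hq)
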